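/- Let $k\ge 2$ and $\mathcal A_k=\{1,\dots,k\}$. For $x\in\mathcal A_k^{\mathbb Z}$ and $n\ge 1$ let $F_x(n)$ be the set of subwords of $x$ of length $n$. A word $u\in F_x(n)$ is called right-special (left-special) if there are letters $a\ne b$ with $ua,ub\in F_x(n+1)$ ($au,bu\in F_x(n+1)$). The sequence $x$ is called an Arnoux--Rauzy sequence if each of its factors occurs in it with bounded gaps, $|F_x(n)|=(k-1)n+1$ for every $n\ge 1$, and each $F_x(n)$, $n\ge1$, contains exactly one right-special and exactly one left-special word. The associated two-sided Arnoux--Rauzy subshift is $$X=\{y\in\mathcal A_k^{\mathbb Z}: F_y(n)=F_x(n)\text{ for every }n\ge 1\},$$ with the topology induced by the product topology of $\mathcal A_k^{\mathbb Z}$ ($\mathcal A_k$ discrete). Let $X$ be any two-sided Arnoux--Rauzy subshift over $\mathcal A_k$ and let $f:\mathcal A_k\to\mathbb R$ be non-constant. For $x\in X$ let $H_x$ be the bounded self-adjoint operator on $\ell^2(\mathbb Z)$ given by $$(H_x\phi)(n)=\phi(n+1)+\phi(n-1)+f(x_n)\phi(n).$$ For $\phi\in\ell^2(\mathbb Z)$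 let $\mu_\phi$ be its spectral measure, that is, the finite Borel measure on $\mathbb R$ with $\langle\phi,(H_x-z)^{-1}\phi\rangle=\int_{\mathbb R}\frac{d\mu_\phi(t)}{t-z}$ for all $z$ with $\operatorname{Im}z>0$; let $\mathcal H_{\rm pp}=\{\phi:\mu_\phi\text{ is pure point}\}$, which is a closed $H_x$-invariant subspace, and let $\sigma_{\rm pp}(H_x)=\sigma(H_x|_{\mathcal H_{\rm pp}})$. Then there is a dense $G_\delta$-subset $G$ of $X$ such that for every $x\in G$ we have $\sigma_{\rm pp}(H_x)=\emptyset$; in particular, $H_x$ has no eigenvalues. -/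

import Mathlib

open MeasureTheory Set
open scoped ENNReal

/-! ### Two-sided Arnoux-Rauzy sequences and subshifts over the alphabet `Fin k` -/

/-- The word `x_j x_{j+1} ... x_{j+n-1}`. -/
def subword {k : ℕ} (x : ℤ → Fin k) (j : ℤ) (n : ℕ) : List (Fin k) :=
  List.ofFn fun i : Fin n => x (j + (i : ℕ))

/-- The set `F_x(n)` of all subwords of `x` of length `n`. -/
def factors {k : ℕ} (x : ℤ → Fin k) (n : ℕ) : Set (List (Fin k)) :=
  {u | ∃ j : ℤ, u = subword x j n}

/-- `u ∈ F_x(n)` has two different extensions to the right in `F_x(n+1)`. -/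
def IsRightSpecial {k : ℕ} (x : ℤ → Fin k) (n : ℕ) (u : List (Fin k)) : Prop :=
  u ∈ factors x n ∧
    ∃ a b : Fin k, a ≠ b ∧ u ++ [a] ∈ factors x (n + 1) ∧ u ++ [b] ∈ factors x (n + 1)

/-- `u ∈ F_x(n)` has two different extensions to the left in `F_x(n+1)`. -/
def IsLeftSpecial {k : ℕ} (x : ℤ → Fin k) (n : ℕ) (u : List (Fin k)) : Prop :=
  u ∈ factors x n ∧
    ∃ a b : Fin k, a ≠ b ∧ a :: u ∈ factors x (n + 1) ∧ b :: u ∈ factors x (n + 1)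

/-- Each factor of `x` occurs in `x` with bounded gaps. -/
def IsUniformlyRecurrent {k : ℕ} (x : ℤ → Fin k) : Prop :=
  ∀ n : ℕ, ∀ u ∈ factors x n, ∃ R : ℕ, ∀ j : ℤ, ∃ i : ℤ,
    j ≤ i ∧ i ≤ j + R ∧ subword x i n = u

/-- Two-sided Arnoux-Rauzy sequences over an alphabet with `k` letters. -/
structure IsArnouxRauzy {k : ℕ} (x : ℤ → Fin k) : Prop where
  uniformlyRecurrent : IsUniformlyRecurrent x
  complexity : ∀ n : ℕ, 1 ≤ n → (factors x n).ncard = (k - 1) * n + 1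
  rightSpecial : ∀ n : ℕ, 1 ≤ n → ∃! u, IsRightSpecial x n u
  leftSpecial : ∀ n : ℕ, 1 ≤ n → ∃! u, IsLeftSpecial x n u

/-- `X` is the two-sided subshift of all sequences that have the same factors as some
Arnoux-Rauzy sequence. -/
def IsArnouxRauzySubshift {k : ℕ} (X : Set (ℤ → Fin k)) : Prop :=
  ∃ x : ℤ → Fin k, IsArnouxRauzy x ∧
    X = {y | ∀ n : ℕ, 1 ≤ n → factors y n = factors x n}

/-! ### Discrete Schrodinger operators on `ℓ²(ℤ)` -/

/-- The Hilbert space `ℓ²(ℤ)` of complex square-summable two-sided sequences. -/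
abbrev EllTwo : Type := lp (fun _ : ℤ => ℂ) 2

/-- The translation `φ ↦ φ(· + m)` on `ℓ²(ℤ)`. -/
noncomputable def shiftOp (m : ℤ) : EllTwo →L[ℂ] EllTwo :=
  LinearMap.mkContinuous
    { toFun := fun φ => ⟨fun n => φ (n + m), by
        have h := (memℓp_gen_iff (p := 2) (by norm_num)).1 φ.2
        exact (memℓp_gen_iff (by norm_num)).2 ((Equiv.addRight m).summable_iff.2 h)⟩
      map_add' := fun φ ψ => rfl
      map_smul' := fun c φ => rfl } 1 (by
    intro φ
    rw [one_mul, lp.norm_eq_tsum_rpow (by norm_num), lp.norm_eq_tsum_rpow (by norm_num)]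
    exact le_of_eq (congrArg (fun t : ℝ => t ^ (1 / (2 : ℝ≥0∞).toReal))
      ((Equiv.addRight m).tsum_eq fun n => ‖φ n‖ ^ (2 : ℝ≥0∞).toReal)))

theorem memlp_mul_of_bound (V : ℤ → ℝ) (C : ℝ) (hC : ∀ n, |V n| ≤ C) (φ : EllTwo) :
    Memℓp (fun n => (V n : ℂ) * φ n) 2 := by
  have h : Memℓp (fun n => (C : ℂ) * φ n) 2 := ((C : ℂ) • φ).2
  refine h.mono' fun n => ?_
  have h0 : 0 ≤ C := (abs_nonneg _).trans (hC n)
  simp only [norm_mul, Complex.norm_real, Real.norm_eq_abs, abs_of_nonneg h0]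
  exact mul_le_mul_of_nonneg_right (hC n) (norm_nonneg _)

/-- Multiplication by the real sequence `V`, bounded by `C`, on `ℓ²(ℤ)`. -/
noncomputable def mulOp (V : ℤ → ℝ) (C : ℝ) (hC : ∀ n, |V n| ≤ C) : EllTwo →L[ℂ] EllTwo :=
  LinearMap.mkContinuous
    { toFun := fun φ => ⟨fun n => (V n : ℂ) * φ n, memlp_mul_of_bound V C hC φ⟩
      map_add' := fun φ ψ => by ext n; exact mul_add _ _ _
      map_smul' := fun c φ => by ext n; simp [mul_left_comm] } C (by
    intro φ
    have h0 : 0 ≤ C := (abs_nonneg _).trans (hC 0)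
    have h1 : ‖(C : ℂ) • φ‖ = C * ‖φ‖ := by
      rw [norm_smul, Complex.norm_real, Real.norm_eq_abs, abs_of_nonneg h0]
    rw [← h1]
    refine lp.norm_mono (by norm_num) fun n => ?_
    simp only [LinearMap.coe_mk, AddHom.coe_mk, lp.coeFn_smul, Pi.smul_apply, smul_eq_mul,
      norm_mul, Complex.norm_real, Real.norm_eq_abs, abs_of_nonneg h0]
    exact mul_le_mul_of_nonneg_right (hC n) (norm_nonneg _))

/-- The discrete Schrodinger operator with bounded potential `V`. -/
noncomputable def schrodingerOp (V : ℤ → ℝ) (C : ℝ) (hC : ∀ n, |V n| ≤ C) :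
    EllTwo →L[ℂ] EllTwo :=
  shiftOp 1 + shiftOp (-1) + mulOp V C hC

theorem schrodingerOp_apply (V : ℤ → ℝ) (C : ℝ) (hC : ∀ n, |V n| ≤ C) (φ : EllTwo) (n : ℤ) :
    schrodingerOp V C hC φ n = φ (n + 1) + φ (n - 1) + (V n : ℂ) * φ n := rfl

/-- The operator `H_x` with potential `V_x(n) = f(x_n)`; the bound on the potential is only
used to know that `H_x` is bounded. -/
noncomputable def schrodingerOfSeq {k : ℕ} (f : Fin k → ℝ) (x : ℤ → Fin k) :
    EllTwo →L[ℂ] EllTwo :=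
  schrodingerOp (fun n => f (x n)) (∑ a, |f a|) fun n =>
    Finset.single_le_sum (f := fun a => |f a|) (fun a _ => abs_nonneg (f a))
      (Finset.mem_univ (x n))

/-! ### Spectral measures and the pure point spectrum -/

section Spectral

variable {E : Type*} [NormedAddCommGroup E] [InnerProductSpace ℂ E] [CompleteSpace E]

/-- `μ` is the spectral measure of `φ` for the (bounded self-adjoint) operator `T`: the finite
Borel measure on `ℝ` with `⟪φ, (T - z)⁻¹ φ⟫ = ∫ dμ(t) / (t - z)` whenever `Im z > 0`. -/
def IsSpectralMeasure (T : E →L[ℂ] E) (φ : E) (μ : Measure ℝ) : Prop :=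
  IsFiniteMeasure μ ∧ ∀ z : ℂ, 0 < z.im →
    inner ℂ φ (Ring.inverse (T - algebraMap ℂ (E →L[ℂ] E) z) φ) =
      ∫ t : ℝ, 1 / ((t : ℂ) - z) ∂μ

/-- A measure is pure point if it is carried by a countable set. -/
def IsPurePoint (μ : Measure ℝ) : Prop :=
  ∃ S : Set ℝ, S.Countable ∧ μ Sᶜ = 0

/-- The vectors whose spectral measure is pure point. -/
def purePointVectors (T : E →L[ℂ] E) : Set E :=
  {φ | ∃ μ : Measure ℝ, IsSpectralMeasure T φ μ ∧ IsPurePoint μ}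

/-- `H_pp` as a closed subspace. For self-adjoint `T` the set `purePointVectors T` is already a
closed subspace (spectral theorem), so that taking the closed span does not add anything. -/
noncomputable def purePointSpace (T : E →L[ℂ] E) : Submodule ℂ E :=
  (Submodule.span ℂ (purePointVectors T)).topologicalClosure

/-- The part of `T` in a closed subspace `K`: `T` restricted to `K`, followed by the orthogonal
projection onto `K`. If `T` maps `K` into itself, this is the restriction of `T` to `K`. -/
noncomputable def partOn (T : E →L[ℂ] E) (K : Submodule ℂ E) [K.HasOrthogonalProjection] :
    K →L[ℂ] K :=
  K.orthogonalProjectionOnto ∘L T ∘L K.subtypeL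

theorem partOn_apply_of_mem (T : E →L[ℂ] E) (K : Submodule ℂ E) [K.HasOrthogonalProjection]
    (φ : K) (h : T φ ∈ K) : (partOn T K φ : E) = T φ :=
  K.starProjection_eq_self_iff.2 h

instance (T : E →L[ℂ] E) : CompleteSpace (purePointSpace T) :=
  (Submodule.isClosed_topologicalClosure _).completeSpace_coe

/-- The pure point spectrum `σ_pp(T) = σ(T |_{H_pp})`, for self-adjoint `T`. -/
noncomputable def ppSpectrum (T : E →L[ℂ] E) : Set ℂ :=
  spectrum ℂ (partOn T (purePointSpace T))

end Spectral

/-!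
The theorem rests on the symmetry of Arnoux-Rauzy sequences under reflection, in the way found by
Jitomirskaya and Simon for the almost Mathieu operator and by Hof, Knill and Simon for subshifts.

*Palindromes.* An Arnoux-Rauzy sequence `x` contains arbitrarily long palindromes
(`IsArnouxRauzy.exists_palindrome`). One follows the bispecial words `w`, starting with the empty
word. The letter `b` after an occurrence of `w` determines the word up to the next occurrence of
`w`, and the invariant `IsPalindromicReturn` says that this next occurrence is preceded by the same
letter `b` and that the complete return word is a palindrome. As there is only one right-special and
one left-special word of each length, the extensions `a w b` that occur are those with `a = s`
or `b = s'`, for some letters `s` and `s'`. If `s` and `s'` were different, then `w` would be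
followed by `s'` forever once it is followed by `s'`, against recurrence; hence `s = s'`
(`IsPalindromicReturn.exists_special`). So the next bispecial word is the complete return word
through `s`, and it satisfies the same invariant (`IsPalindromicReturn.succ`).

*Genericity.* By uniform recurrence each word of `x` occurs at a bounded distance from the centre of
palindromes of any length. Hence the elements of the compact space `X` that have a palindrome
with centre `c / 2`, `c ≥ N`, which is very long compared with `c`, form a dense open set for each
`N`, and Baire's theorem applies (`isGδ_dense_stronglyPalindromic`).

*No eigenvalues.* Let `φ` be a square-summable eigenfunction. The Wronskian of `φ` and of
its reflection about `c / 2` is constant on the palindrome and summable, hence tiny. Its value at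
the centre factorizes, which shows that `φ` is almost even or almost odd there. Propagating this to
the origin, where the exponential loss in `c` is still compensated by the length of the palindrome,
one finds that `φ 0` and `φ 1` are at most about as large as `φ c` and `φ (c - 1)`. These tend to
zero, so `φ = 0` (`IsStronglyPalindromic.eq_zero_of_solution`).

*Spectral measures.* If a self-adjoint `T` has no eigenvalues, then
`ε (T - a - i ε)⁻¹ φ → 0` as `ε → 0`, so that no spectral measure has point masses. A pure point
spectral measure is therefore zero, and so is its vector
(`IsSelfAdjoint.purePointVectors_subset`); the pure point subspace is trivial, and the spectrum of
an operator on the trivial space is empty.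
-/

/-! ### Special words of Arnoux-Rauzy sequences, in terms of positions -/

section Words

variable {k : ℕ} {x : ℤ → Fin k}

theorem subword_succ (x : ℤ → Fin k) (j : ℤ) (n : ℕ) :
    subword x j (n + 1) = subword x j n ++ [x (j + n)] := by
  rw [subword, List.ofFn_succ_last]
  simp [subword]

theorem subword_succ' (x : ℤ → Fin k) (j : ℤ) (n : ℕ) :
    subword x j (n + 1) = x j :: subword x (j + 1) n := by
  simp only [subword, List.ofFn_succ]
  simp [add_comm, add_left_comm]

theorem subword_eq_iff {y z : ℤ → Fin k} {i j : ℤ} {n : ℕ} :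
    subword y i n = subword z j n ↔ ∀ t : ℤ, 0 ≤ t → t < n → y (i + t) = z (j + t) := by
  simp only [subword, List.ofFn_inj, funext_iff]
  constructor
  · intro h t h0 h1
    lift t to ℕ using h0
    exact h ⟨t, by exact_mod_cast h1⟩
  · intro h t
    exact h _ (by positivity) (by exact_mod_cast t.2)

theorem length_subword (x : ℤ → Fin k) (j : ℤ) (n : ℕ) : (subword x j n).length = n := by
  simp [subword]

theorem finite_factors (x : ℤ → Fin k) (n : ℕ) : (factors x n).Finite := by
  refine (List.finite_length_eq (Fin k) n).subset ?_
  rintro u ⟨j, rfl⟩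
  exact length_subword x j n

theorem isRightSpecial_of_ne {n : ℕ} {i j : ℤ} (h : subword x i n = subword x j n)
    (hne : x (i + n) ≠ x (j + n)) : IsRightSpecial x n (subword x i n) :=
  ⟨⟨i, rfl⟩, x (i + n), x (j + n), hne, ⟨i, (subword_succ x i n).symm⟩,
    ⟨j, by rw [subword_succ, h]⟩⟩

theorem isLeftSpecial_of_ne {n : ℕ} {i j : ℤ} (h : subword x i n = subword x j n)
    (hne : x (i - 1) ≠ x (j - 1)) : IsLeftSpecial x n (subword x i n) :=
  ⟨⟨i, rfl⟩, x (i - 1), x (j - 1), hne, ⟨i - 1, by simp [subword_succ']⟩,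
    ⟨j - 1, by simp [subword_succ', h]⟩⟩

/-- If words of `F'` are one-letter extensions `e v a` of words `v ∈ F`, if there are `k - 1` more
words in `F'` than in `F`, and if only `u` has more than one extension, then `u` can be extended
by every letter. -/
theorem forall_extension_mem {e : List (Fin k) → Fin k → List (Fin k)}
    {F F' : Set (List (Fin k))} (hF : F.Finite) (hF' : F'.Finite)
    (hcard : F'.ncard = F.ncard + (k - 1)) (hcover : ∀ w ∈ F', ∃ v ∈ F, ∃ a, w = e v a)
    {u : List (Fin k)} (hu : u ∈ F)
    (huniq : ∀ v ∈ F, v ≠ u → ∀ a b, e v a ∈ F' → e v b ∈ F' → a = b) (b : Fin k) :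
    e u b ∈ F' := by
  classical
  lift F to Finset (List (Fin k)) using hF
  lift F' to Finset (List (Fin k)) using hF'
  simp only [Set.ncard_coe_finset, Finset.mem_coe] at *
  let B : List (Fin k) → Finset (Fin k) := fun v => Finset.univ.filter fun a => e v a ∈ F'
  have h1 : F'.card ≤ ∑ v ∈ F, (B v).card := by
    have hsub : F' ⊆ F.biUnion fun v => (B v).image (e v) := by
      intro w hw
      obtain ⟨v, hv, a, rfl⟩ := hcover w hw
      exact Finset.mem_biUnion.2 ⟨v, hv, Finset.mem_image.2 ⟨a, by simp [B, hw], rfl⟩⟩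
    exact (Finset.card_le_card hsub).trans <| Finset.card_biUnion_le.trans <|
      Finset.sum_le_sum fun v _ => Finset.card_image_le
  have h2 : ∑ v ∈ F.erase u, (B v).card ≤ (F.erase u).card := by
    rw [Finset.card_eq_sum_ones]
    refine Finset.sum_le_sum fun v hv => Finset.card_le_one.2 fun a ha c hc => ?_
    rw [Finset.mem_erase] at hv
    simp only [B, Finset.mem_filter, Finset.mem_univ, true_and] at ha hc
    exact huniq v hv.2 hv.1 a c ha hc
  rw [← Finset.add_sum_erase F _ hu] at h1
  rw [Finset.card_erase_of_mem hu] at h2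
  have h3 : 0 < F.card := Finset.card_pos.2 ⟨u, hu⟩
  have hk : 0 < k := b.pos
  have h4 : B u = Finset.univ := by
    refine Finset.eq_univ_of_card _ (le_antisymm (Finset.card_le_univ _) ?_)
    rw [Fintype.card_fin]
    omega
  have h5 : b ∈ B u := h4 ▸ Finset.mem_univ b
  simpa [B] using h5

theorem IsArnouxRauzy.ncard_factors_succ (hx : IsArnouxRauzy x) {n : ℕ} (hn : 1 ≤ n) :
    (factors x (n + 1)).ncard = (factors x n).ncard + (k - 1) := by
  rw [hx.complexity n hn, hx.complexity (n + 1) (by omega)]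
  ring

/-- The right-special word of each length is followed by every letter. -/
theorem IsArnouxRauzy.exists_forall_right (hx : IsArnouxRauzy x) {n : ℕ} (hn : 1 ≤ n) :
    ∃ i, ∀ b, ∃ j, subword x j n = subword x i n ∧ x (j + n) = b := by
  obtain ⟨u, ⟨⟨i, rfl⟩, -⟩, hun⟩ := hx.rightSpecial n hn
  refine ⟨i, fun b => ?_⟩
  obtain ⟨j, hj⟩ := forall_extension_mem (e := fun v a => v ++ [a]) (finite_factors x n)
    (finite_factors x (n + 1)) (hx.ncard_factors_succ hn)
    (by
      rintro w ⟨j, rfl⟩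
      exact ⟨_, ⟨j, rfl⟩, _, subword_succ x j n⟩)
    (u := subword x i n) ⟨i, rfl⟩
    (fun v hv hne a c ha hc => by
      by_contra hac
      exact hne (hun v ⟨hv, a, c, hac, ha, hc⟩)) b
  rw [subword_succ] at hj
  obtain ⟨h1, h2⟩ := List.append_inj' hj rfl
  exact ⟨j, h1.symm, by simpa using h2.symm⟩

/-- The left-special word of each length is preceded by every letter. -/
theorem IsArnouxRauzy.exists_forall_left (hx : IsArnouxRauzy x) {n : ℕ} (hn : 1 ≤ n) :
    ∃ i, ∀ a, ∃ j, subword x j n = subword x i n ∧ x (j - 1) = a := by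
  obtain ⟨u, ⟨⟨i, rfl⟩, -⟩, hun⟩ := hx.leftSpecial n hn
  refine ⟨i, fun b => ?_⟩
  obtain ⟨j, hj⟩ := forall_extension_mem (e := fun v a => a :: v) (finite_factors x n)
    (finite_factors x (n + 1)) (hx.ncard_factors_succ hn)
    (by
      rintro w ⟨j, rfl⟩
      exact ⟨_, ⟨j + 1, rfl⟩, _, subword_succ' x j n⟩)
    (u := subword x i n) ⟨i, rfl⟩
    (fun v hv hne a c ha hc => by
      by_contra hac
      exact hne (hun v ⟨hv, a, c, hac, ha, hc⟩)) b
  rw [subword_succ', List.cons.injEq] at hj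
  exact ⟨j + 1, hj.2.symm, by simpa using hj.1.symm⟩

theorem IsArnouxRauzy.right_unique (hx : IsArnouxRauzy x) {n : ℕ} {i i' j j' : ℤ}
    (hi : subword x i n = subword x i' n) (hi' : x (i + n) ≠ x (i' + n))
    (hj : subword x j n = subword x j' n) (hj' : x (j + n) ≠ x (j' + n)) :
    subword x i n = subword x j n := by
  rcases Nat.eq_zero_or_pos n with rfl | hn
  · simp [subword]
  · exact (hx.rightSpecial n hn).unique (isRightSpecial_of_ne hi hi') (isRightSpecial_of_ne hj hj')

theorem IsArnouxRauzy.left_unique (hx : IsArnouxRauzy x) {n : ℕ} {i i' j j' : ℤ}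
    (hi : subword x i n = subword x i' n) (hi' : x (i - 1) ≠ x (i' - 1))
    (hj : subword x j n = subword x j' n) (hj' : x (j - 1) ≠ x (j' - 1)) :
    subword x i n = subword x j n := by
  rcases Nat.eq_zero_or_pos n with rfl | hn
  · simp [subword]
  · exact (hx.leftSpecial n hn).unique (isLeftSpecial_of_ne hi hi') (isLeftSpecial_of_ne hj hj')

theorem IsArnouxRauzy.exists_eq (hx : IsArnouxRauzy x) (b : Fin k) : ∃ i, x i = b := by
  have h1 : (factors x 1).ncard = k := by
    rw [hx.complexity 1 le_rfl]
    have := b.pos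
    omega
  have h2 : factors x 1 = range fun i => [x i] := by
    ext u
    simp [factors, subword, eq_comm]
  have h3 : (range fun i => [x i]) = (fun a => [a]) '' range x := by
    rw [← range_comp]; rfl
  rw [h2, h3, Set.ncard_image_of_injective _ (fun a c h => by simpa using h)] at h1
  have h4 : range x = univ := by
    rw [eq_univ_iff_ncard, h1, Nat.card_fin]
  exact (h4 ▸ mem_univ b : b ∈ range x)

end Words

/-! ### Return words of bispecial words, and long palindromes -/

/-- `O` is the set of all occurrences of a word `w` of length `L` in `x`, where `w` can be followed
by every letter, and the letter `b` that follows an occurrence of `w` determines the word up to the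
end of the next occurrence of `w`. This next occurrence is `ℓ b` places further on, it is
preceded by the letter `b`, and the complete return word, of length `ℓ b + L`, is a palindrome. -/
structure IsPalindromicReturn {k : ℕ} (x : ℤ → Fin k) (L : ℕ) (O : Set ℤ) (ℓ : Fin k → ℕ) :
    Prop where
  mem_iff : ∀ i ∈ O, ∀ j, j ∈ O ↔ ∀ t : ℤ, 0 ≤ t → t < L → x (j + t) = x (i + t)
  pos : ∀ b, 0 < ℓ b
  letter : ∀ b, ∃ i ∈ O, x (i + L) = b
  next : ∀ i ∈ O, i + ℓ (x (i + L)) ∈ O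
  gap : ∀ i ∈ O, ∀ j ∈ O, i < j → i + ℓ (x (i + L)) ≤ j
  last : ∀ i ∈ O, x (i + ℓ (x (i + L)) - 1) = x (i + L)
  det : ∀ i ∈ O, ∀ j ∈ O, x (i + L) = x (j + L) →
    ∀ t : ℤ, 0 ≤ t → t < ℓ (x (i + L)) + L → x (i + t) = x (j + t)
  pal : ∀ i ∈ O, ∀ n : ℤ, i ≤ n → n < i + ℓ (x (i + L)) + L →
    x (2 * i + ℓ (x (i + L)) + L - 1 - n) = x n

section Palindromes

variable {k : ℕ} {x : ℤ → Fin k}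

theorem IsUniformlyRecurrent.exists_ge (hx : IsUniformlyRecurrent x) (i : ℤ) (n : ℕ) (m : ℤ) :
    ∃ j, m ≤ j ∧ subword x j n = subword x i n := by
  obtain ⟨R, hR⟩ := hx n _ ⟨i, rfl⟩
  obtain ⟨j, h1, -, h2⟩ := hR m
  exact ⟨j, h1, h2⟩

theorem IsUniformlyRecurrent.exists_lt (hx : IsUniformlyRecurrent x) (i : ℤ) (n : ℕ) (m : ℤ) :
    ∃ j, j < m ∧ subword x j n = subword x i n := by
  obtain ⟨R, hR⟩ := hx n _ ⟨i, rfl⟩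
  obtain ⟨j, -, h1, h2⟩ := hR (m - R - 1)
  exact ⟨j, by omega, h2⟩

namespace IsPalindromicReturn

variable {L : ℕ} {O : Set ℤ} {ℓ : Fin k → ℕ}

theorem mem_iff_subword (h : IsPalindromicReturn x L O ℓ) {i j : ℤ} (hi : i ∈ O) :
    j ∈ O ↔ subword x j L = subword x i L := by
  rw [h.mem_iff i hi, subword_eq_iff]

/-- Every occurrence of `w` is the first one after some other occurrence of `w`. -/
theorem exists_prev (hx : IsUniformlyRecurrent x) (h : IsPalindromicReturn x L O ℓ) {j : ℤ}
    (hj : j ∈ O) : ∃ i ∈ O, i + ℓ (x (i + L)) = j := by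
  obtain ⟨i₀, hi₀, hi₀'⟩ := hx.exists_lt j L j
  obtain ⟨i, ⟨hi, hij⟩, hmax⟩ := Int.exists_greatest_of_bdd (P := fun i => i ∈ O ∧ i < j)
    ⟨j, fun z hz => hz.2.le⟩ ⟨i₀, (h.mem_iff_subword hj).2 hi₀', hi₀⟩
  refine ⟨i, hi, le_antisymm (h.gap i hi j hj hij) ?_⟩
  by_contra! hlt
  have h1 := hmax _ ⟨h.next i hi, hlt⟩
  have h2 := h.pos (x (i + L))
  omega

/-- `w` can be preceded by every letter. -/
theorem letter_left (h : IsPalindromicReturn x L O ℓ) (a : Fin k) : ∃ i ∈ O, x (i - 1) = a := by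
  obtain ⟨i, hi, rfl⟩ := h.letter a
  exact ⟨_, h.next i hi, h.last i hi⟩

/-- Some `a w` can be followed by every letter: it is the right-special word of length `L + 1`,
whose suffix `w` is then right-special of length `L`. -/
theorem exists_right (hk : 2 ≤ k) (hx : IsArnouxRauzy x) (h : IsPalindromicReturn x L O ℓ) :
    ∃ a, ∀ b, ∃ j ∈ O, x (j - 1) = a ∧ x (j + L) = b := by
  obtain ⟨i, hi⟩ := hx.exists_forall_right (n := L + 1) (by omega)
  let b₀ : Fin k := ⟨0, by omega⟩
  let b₁ : Fin k := ⟨1, by omega⟩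
  have hb : b₀ ≠ b₁ := by simp [b₀, b₁]
  obtain ⟨j₀, hj₀, hj₀'⟩ := h.letter b₀
  obtain ⟨j₁, hj₁, hj₁'⟩ := h.letter b₁
  have key : ∀ j, subword x j (L + 1) = subword x i (L + 1) →
      x j = x i ∧ subword x (j + 1) L = subword x (i + 1) L := by
    intro j hj
    simpa [subword_succ'] using hj
  have hiO : i + 1 ∈ O := by
    obtain ⟨m₀, hm₀, hm₀'⟩ := hi b₀
    obtain ⟨m₁, hm₁, hm₁'⟩ := hi b₁
    push_cast at hm₀' hm₁'
    rw [h.mem_iff_subword hj₀, ← (key _ hm₀).2]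
    refine hx.right_unique (i' := m₁ + 1) (j' := j₁) ?_ ?_ ?_ ?_
    · rw [(key _ hm₀).2, (key _ hm₁).2]
    · rwa [add_assoc, add_comm 1, hm₀', add_assoc, add_comm 1, hm₁']
    · exact ((h.mem_iff_subword hj₁).1 hj₀)
    · rwa [hj₀', hj₁']
  refine ⟨x i, fun b => ?_⟩
  obtain ⟨m, hm, hm'⟩ := hi b
  refine ⟨m + 1, (h.mem_iff_subword hiO).2 (key m hm).2, by simpa using (key m hm).1, ?_⟩
  rw [← hm']
  push_cast
  ring_nf

/-- Some `w b` can be preceded by every letter: it is the left-special word of length `L + 1`. -/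
theorem exists_left (hk : 2 ≤ k) (hx : IsArnouxRauzy x) (h : IsPalindromicReturn x L O ℓ) :
    ∃ b, ∀ a, ∃ j ∈ O, x (j - 1) = a ∧ x (j + L) = b := by
  obtain ⟨i, hi⟩ := hx.exists_forall_left (n := L + 1) (by omega)
  let b₀ : Fin k := ⟨0, by omega⟩
  let b₁ : Fin k := ⟨1, by omega⟩
  have hb : b₀ ≠ b₁ := by simp [b₀, b₁]
  obtain ⟨j₀, hj₀, hj₀'⟩ := h.letter_left b₀
  obtain ⟨j₁, hj₁, hj₁'⟩ := h.letter_left b₁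
  have key : ∀ j, subword x j (L + 1) = subword x i (L + 1) →
      subword x j L = subword x i L ∧ x (j + L) = x (i + L) := by
    intro j hj
    rw [subword_succ, subword_succ] at hj
    obtain ⟨h1, h2⟩ := List.append_inj' hj rfl
    exact ⟨h1, by simpa using h2⟩
  have hiO : i ∈ O := by
    obtain ⟨m₀, hm₀, hm₀'⟩ := hi b₀
    obtain ⟨m₁, hm₁, hm₁'⟩ := hi b₁
    rw [h.mem_iff_subword hj₀, ← (key _ hm₀).1]
    refine hx.left_unique (i' := m₁) (j' := j₁) ?_ ?_ ?_ ?_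
    · rw [(key _ hm₀).1, (key _ hm₁).1]
    · rwa [hm₀', hm₁']
    · exact ((h.mem_iff_subword hj₁).1 hj₀)
    · rwa [hj₀', hj₁']
  refine ⟨x (i + L), fun a => ?_⟩
  obtain ⟨m, hm, hm'⟩ := hi a
  exact ⟨m, (h.mem_iff_subword hiO).2 (key m hm).1, hm', (key m hm).2⟩

/-- The extensions of `w` on both sides form a cross: there is one letter `s` such that `s w` can
be followed by every letter, while `a w` with `a ≠ s` can be followed only by `s`. -/
theorem exists_special (hk : 2 ≤ k) (hx : IsArnouxRauzy x) (h : IsPalindromicReturn x L O ℓ) :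
    ∃ s, (∀ b, ∃ j ∈ O, x (j - 1) = s ∧ x (j + L) = b) ∧
      ∀ j ∈ O, x (j - 1) ≠ s → x (j + L) = s := by
  obtain ⟨s, hs⟩ := h.exists_right hk hx
  obtain ⟨s', hs'⟩ := h.exists_left hk hx
  have huniq : ∀ j ∈ O, x (j - 1) ≠ s → x (j + L) = s' := by
    intro j hj hjs
    obtain ⟨m, hm, hm1, hm2⟩ := hs' (x (j - 1))
    by_contra hne
    obtain ⟨b, hb⟩ : ∃ b, b ≠ s' := ⟨_, hne⟩
    obtain ⟨p, hp, hp1, hp2⟩ := hs b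
    obtain ⟨q, hq, hq1, hq2⟩ := hs s'
    have hlen : ∀ a : ℤ, a - 1 + ((L + 1 : ℕ) : ℤ) = a + L := fun a => by push_cast; ring
    have hext : ∀ a ∈ O, ∀ c ∈ O, x (a - 1) = x (c - 1) →
        subword x (a - 1) (L + 1) = subword x (c - 1) (L + 1) := by
      intro a ha c hc hac
      rw [subword_succ', subword_succ', hac, sub_add_cancel, sub_add_cancel,
        (h.mem_iff_subword hc).1 ha]
    have := hx.right_unique (hext j hj m hm hm1.symm) (by rwa [hlen, hlen, hm2])
      (hext p hp q hq (hp1.trans hq1.symm)) (by rwa [hlen, hlen, hp2, hq2])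
    rw [subword_succ', subword_succ', hp1] at this
    exact hjs (List.cons.inj this).1
  suffices hss : s' = s by
    subst hss
    exact ⟨s', hs, huniq⟩
  by_contra hne
  -- Otherwise `w s'` leads to the next occurrence of `w`, preceded by `s' ≠ s`, hence followed
  -- by `s'` again: from there on `w` is followed by `s'` only, against recurrence.
  obtain ⟨i, hi, hi'⟩ := h.letter s'
  have hstep : ∀ n : ℕ, i + n * ℓ s' ∈ O ∧ x (i + n * ℓ s' + L) = s' := by
    intro n
    induction n with
    | zero => simpa using ⟨hi, hi'⟩
    | succ n ih =>
      have h1 := h.next _ ih.1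
      have h2 := h.last _ ih.1
      rw [ih.2] at h1 h2
      have h3 : i + ((n + 1 : ℕ) : ℤ) * ℓ s' = i + n * ℓ s' + ℓ s' := by push_cast; ring
      rw [h3]
      exact ⟨h1, huniq _ h1 (by rwa [h2])⟩
  have hall : ∀ j ∈ O, i ≤ j → x (j + L) = s' := by
    intro j hj hij
    have hpos : (0 : ℤ) < ℓ s' := by exact_mod_cast h.pos s'
    obtain ⟨n, hn⟩ : ∃ n : ℕ, (n : ℤ) = (j - i) / ℓ s' :=
      ⟨((j - i) / ℓ s').toNat, Int.toNat_of_nonneg (Int.ediv_nonneg (by omega) hpos.le)⟩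
    have h1 : (n : ℤ) * ℓ s' ≤ j - i := hn ▸ Int.ediv_mul_le _ hpos.ne'
    have h2 : j - i < (n : ℤ) * ℓ s' + ℓ s' := by
      have := Int.lt_ediv_add_one_mul_self (j - i) hpos
      rw [← hn] at this
      linarith
    obtain ⟨h3, h4⟩ := hstep n
    rcases (show i + n * ℓ s' ≤ j by linarith).eq_or_lt with h5 | h5
    · rw [← h5, h4]
    · have := h.gap _ h3 j hj h5
      rw [h4] at this
      linarith
  obtain ⟨m, hm, hm'⟩ := h.letter s
  obtain ⟨j, hj, hj'⟩ := hx.uniformlyRecurrent.exists_ge m (L + 1) i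
  rw [subword_succ, subword_succ] at hj'
  obtain ⟨h1, h2⟩ := List.append_inj' hj' rfl
  have h3 := hall j ((h.mem_iff_subword hm).2 h1) hj
  have h4 : x (j + L) = x (m + L) := by simpa using h2
  exact hne (by rw [← h3, h4, hm'])

/-- The next bispecial word `w'` is the complete return word to `w` through the special letter `s`.
Its occurrences are those of `w s`. After `w' b`, the next occurrence of `w'` is the next occurrence
of `w` if `b = s`, and the second next one if `b ≠ s`, so that its complete return words are
overlaps of complete return words to `w`, in the order `s, s` or `s, b, s`. -/
theorem succ (hk : 2 ≤ k) (hx : IsArnouxRauzy x) (h : IsPalindromicReturn x L O ℓ) :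
    ∃ L' O' ℓ', L < L' ∧ IsPalindromicReturn x L' O' ℓ' := by
  classical
  obtain ⟨s, hs, huniq⟩ := h.exists_special hk hx
  have hsp := h.pos s
  have hO : ∀ i, i ∈ O ∧ x (i + L) = s → i + ℓ s ∈ O ∧ x (i + ℓ s - 1) = s := by
    rintro i ⟨hi, his⟩
    have h1 := h.next i hi
    have h2 := h.last i hi
    rw [his] at h1 h2
    exact ⟨h1, h2⟩
  have hdet : ∀ i, i ∈ O ∧ x (i + L) = s → ∀ j, j ∈ O ∧ x (j + L) = s →
      ∀ t : ℤ, 0 ≤ t → t < ℓ s + L → x (i + t) = x (j + t) := by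
    rintro i ⟨hi, his⟩ j ⟨hj, hjs⟩ t ht ht'
    exact h.det i hi j hj (his.trans hjs.symm) t ht (by rwa [his])
  have hpal : ∀ i, i ∈ O ∧ x (i + L) = s → ∀ n : ℤ, i ≤ n → n < i + ℓ s + L →
      x (2 * i + ℓ s + L - 1 - n) = x n := by
    rintro i ⟨hi, his⟩ n hn hn'
    have := h.pal i hi n hn (by rwa [his])
    rwa [his] at this
  -- the other letters: two return words are traversed
  have hne : ∀ i, i ∈ O ∧ x (i + L) = s → ∀ b, b ≠ s → x (i + ℓ s + L) = b →
      i + ℓ s + ℓ b ∈ O ∧ x (i + ℓ s + ℓ b - 1) = b ∧ x (i + ℓ s + ℓ b + L) = s := by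
    rintro i hi b hb hib
    obtain ⟨h1, h2⟩ := hO i hi
    have h3 := h.next _ h1
    have h4 := h.last _ h1
    rw [hib] at h3 h4
    exact ⟨h3, h4, huniq _ h3 (by rwa [h4])⟩
  have hcast : ∀ i : ℤ, i + ((L + ℓ s : ℕ) : ℤ) = i + ℓ s + L := fun i => by push_cast; ring
  refine ⟨L + ℓ s, {i | i ∈ O ∧ x (i + L) = s}, fun b => if b = s then ℓ s else ℓ s + ℓ b,
    by omega, ?_, ?_, ?_, ?_, ?_, ?_, ?_, ?_⟩
  · rintro i hi j
    constructor
    · intro hj t ht ht'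
      exact hdet j hj i hi t ht (by push_cast at ht'; linarith)
    · intro hj
      push_cast at hj
      refine ⟨(h.mem_iff i hi.1 j).2 fun t ht ht' => hj t ht (by omega), ?_⟩
      rw [hj L (by omega) (by omega), hi.2]
  · intro b
    split_ifs <;> omega
  · intro b
    obtain ⟨j, hj, hj1, hj2⟩ := hs b
    obtain ⟨i, hi, rfl⟩ := h.exists_prev hx.uniformlyRecurrent hj
    have h1 := h.last i hi
    rw [hj1] at h1
    refine ⟨i, ⟨hi, h1.symm⟩, ?_⟩
    rw [hcast, ← hj2, ← h1]
  · intro i hi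
    rw [hcast]
    split_ifs with hb
    · exact ⟨(hO i hi).1, hb⟩
    · have := hne i hi _ hb rfl
      push_cast
      rw [← add_assoc]
      exact ⟨this.1, this.2.2⟩
  · intro i hi j hj hij
    have h1 := h.gap i hi.1 j hj.1 hij
    rw [hi.2] at h1
    rw [hcast]
    split_ifs with hb
    · exact h1
    · rcases h1.eq_or_lt with h2 | h2
      · exact absurd (h2 ▸ hj.2) hb
      · have := h.gap _ (hO i hi).1 j hj.1 h2
        push_cast
        linarith
  · intro i hi
    rw [hcast]
    split_ifs with hb
    · rw [(hO i hi).2, hb]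
    · have := hne i hi _ hb rfl
      push_cast
      rw [← add_assoc]
      exact this.2.1
  · intro i hi j hj hij t ht ht'
    rw [hcast, hcast] at hij
    simp only [hcast] at ht'
    rcases lt_or_ge t (ℓ s + L) with h1 | h1
    · exact hdet i hi j hj t ht h1
    · split_ifs at ht' with hb
      · have := hdet _ ⟨(hO i hi).1, hb⟩ _ ⟨(hO j hj).1, hij ▸ hb⟩ (t - ℓ s) (by omega) (by omega)
        ring_nf at this ⊢
        exact this
      · push_cast at ht'
        rcases lt_or_ge t (ℓ s + ℓ (x (i + ℓ s + L)) + L) with h2 | h2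
        · have := h.det _ (hO i hi).1 _ (hO j hj).1 hij (t - ℓ s) (by omega) (by linarith)
          ring_nf at this ⊢
          exact this
        · have h3 := hne i hi _ hb rfl
          have h4 := hne j hj _ hb hij.symm
          have := hdet _ ⟨h3.1, h3.2.2⟩ _ ⟨h4.1, h4.2.2⟩ (t - ℓ s - ℓ (x (i + ℓ s + L)))
            (by omega) (by omega)
          convert this using 2 <;> ring
  · intro i hi n hn hn'
    simp only [hcast] at hn' ⊢
    -- the complete return word at `i` occurs again at the next occurrence
    split_ifs at hn' ⊢ with hb
    · have hi₁ : i + ℓ s ∈ O ∧ x (i + ℓ s + L) = s := ⟨(hO i hi).1, hb⟩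
      rcases lt_or_ge n (i + ℓ s + L) with h1 | h1
      · rw [← hpal i hi n hn h1]
        have := hdet i hi _ hi₁ (i + ℓ s + L - 1 - n) (by omega) (by omega)
        convert this.symm using 2 <;> ring
      · rw [← hpal _ hi₁ n (by omega) (by omega)]
        have := hdet i hi _ hi₁ (i + 2 * ℓ s + L - 1 - n) (by omega) (by omega)
        convert this using 2 <;> ring
    · have h3 := hne i hi _ hb rfl
      have h4 := h.pal _ (hO i hi).1 n
      set r := ℓ (x (i + ℓ s + L)) with hr
      have hi₁ : i + ℓ s + r ∈ O ∧ x (i + ℓ s + r + L) = s := ⟨h3.1, h3.2.2⟩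
      push_cast at hn' ⊢
      rcases lt_or_ge n (i + ℓ s + L) with h1 | h1
      · rw [← hpal i hi n hn h1]
        have := hdet i hi _ hi₁ (i + ℓ s + L - 1 - n) (by omega) (by omega)
        convert this.symm using 2 <;> ring
      · rcases lt_or_ge n (i + ℓ s + r) with h2 | h2
        · rw [← h4 (by omega) (by omega)]
          congr 1
          ring
        · rw [← hpal _ hi₁ n (by omega) (by omega)]
          have := hdet i hi _ hi₁ (i + ℓ s + r + ℓ s + L - 1 - n) (by omega) (by omega)
          convert this using 2 <;> ring

/-- The empty word occurs everywhere, and its complete return words are the letters. -/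
theorem zero (hx : IsArnouxRauzy x) : IsPalindromicReturn x 0 univ fun _ => 1 where
  mem_iff i _ j := by
    simp only [mem_univ, true_iff]
    intro t ht ht'
    push_cast at ht'
    omega
  pos _ := one_pos
  letter b := by
    obtain ⟨i, hi⟩ := hx.exists_eq b
    exact ⟨i, mem_univ i, by simpa using hi⟩
  next _ _ := mem_univ _
  gap i _ j _ hij := by push_cast; omega
  last i _ := by simp
  det i _ j _ hij t ht ht' := by
    push_cast at ht'
    obtain rfl : t = 0 := by omega
    simpa using hij
  pal i _ n hn hn' := by
    push_cast at hn' ⊢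
    obtain rfl : n = i := by omega
    congr 1
    ring

end IsPalindromicReturn

/-- An Arnoux-Rauzy sequence contains arbitrarily long palindromes. -/
theorem IsArnouxRauzy.exists_palindrome (hk : 2 ≤ k) (hx : IsArnouxRauzy x) (N : ℕ) :
    ∃ (i : ℤ) (L : ℕ), N ≤ L ∧ ∀ n : ℤ, i ≤ n → n < i + L → x (2 * i + L - 1 - n) = x n := by
  have hex : ∀ N : ℕ, ∃ L O ℓ, N ≤ L ∧ IsPalindromicReturn x L O ℓ := by
    intro N
    induction N with
    | zero => exact ⟨0, _, _, le_rfl, .zero hx⟩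
    | succ N ih =>
      obtain ⟨L, O, ℓ, hL, h⟩ := ih
      obtain ⟨L', O', ℓ', hL', h'⟩ := h.succ hk hx
      exact ⟨L', O', ℓ', by omega, h'⟩
  obtain ⟨L, O, ℓ, hL, h⟩ := hex N
  obtain ⟨i, hi, -⟩ := h.letter (x 0)
  refine ⟨i, ℓ (x (i + L)) + L, by omega, fun n hn hn' => ?_⟩
  have := h.pal i hi n hn (by push_cast at hn'; linarith)
  push_cast
  rwa [← add_assoc]

end Palindromes

/-! ### Strongly palindromic sequences are generic -/

/-- The sequence `x` contains palindromes with centres `c / 2` arbitrarily far to the right which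
extend beyond `[0, c]` by a length that is superexponential in `c`. The particular value
`(c + 1) ^ (2 * c + 4)` eventually beats `K ^ (2 * c)` for every `K`. -/
def IsStronglyPalindromic {A : Type*} (x : ℤ → A) : Prop :=
  ∀ N : ℕ, ∃ c : ℕ, N ≤ c ∧ ∀ n : ℤ, -((c + 1) ^ (2 * c + 4) : ℕ) ≤ n →
    n ≤ c + ((c + 1) ^ (2 * c + 4) : ℕ) → x (c - n) = x n

section Generic

variable {k : ℕ} {x : ℤ → Fin k}

theorem subword_comp_add (x : ℤ → Fin k) (m j : ℤ) (n : ℕ) :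
    subword (fun i => x (i + m)) j n = subword x (j + m) n := by
  rw [subword_eq_iff]
  intro t _ _
  congr 1
  ring

theorem factors_comp_add (x : ℤ → Fin k) (m : ℤ) (n : ℕ) :
    factors (fun i => x (i + m)) n = factors x n := by
  ext u
  simp only [factors, mem_ofPred_eq, subword_comp_add]
  exact ⟨fun ⟨j, hj⟩ => ⟨j + m, hj⟩, fun ⟨j, hj⟩ => ⟨j - m, by simpa using hj⟩⟩

/-- By uniform recurrence, a sequence all of whose factors occur in `x` has all factors of `x`. -/
theorem IsUniformlyRecurrent.factors_eq_iff (hx : IsUniformlyRecurrent x) {y : ℤ → Fin k} :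
    (∀ n, 1 ≤ n → factors y n = factors x n) ↔ ∀ n j, subword y j n ∈ factors x n := by
  constructor
  · intro h n j
    rcases Nat.eq_zero_or_pos n with rfl | hn
    · exact ⟨0, by simp [subword]⟩
    · exact h n hn ▸ ⟨j, rfl⟩
  · intro h n _
    refine Subset.antisymm ?_ fun u hu => ?_
    · rintro _ ⟨j, rfl⟩
      exact h n j
    · obtain ⟨R, hR⟩ := hx n u hu
      obtain ⟨p, hp⟩ := h (R + n) 0
      obtain ⟨i, hi, hi', rfl⟩ := hR p
      refine ⟨i - p, ?_⟩
      rw [subword_eq_iff] at hp ⊢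
      intro t ht ht'
      have := hp (i - p + t) (by omega) (by push_cast; omega)
      rw [zero_add] at this
      rw [this]
      congr 1
      ring

theorem isClosed_of_arnouxRauzy {X : Set (ℤ → Fin k)} (hX : IsArnouxRauzySubshift X) :
    IsClosed X := by
  obtain ⟨x, hx, rfl⟩ := hX
  simp only [hx.uniformlyRecurrent.factors_eq_iff, ofPred_forall]
  refine isClosed_iInter fun n => isClosed_iInter fun j => ?_
  have hcont : Continuous fun y : ℤ → Fin k => fun i : Fin n => y (j + (i : ℕ)) := by fun_prop
  exact (isClosed_discrete {v : Fin n → Fin k | List.ofFn v ∈ factors x n}).preimage hcont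

theorem isOpen_setOf_palindrome {X : Set (ℤ → Fin k)} (c a b : ℤ) :
    IsOpen {y : X | ∀ n : ℤ, a ≤ n → n ≤ b → (y : ℤ → Fin k) (c - n) = (y : ℤ → Fin k) n} := by
  have h : {y : X | ∀ n : ℤ, a ≤ n → n ≤ b → (y : ℤ → Fin k) (c - n) = (y : ℤ → Fin k) n} =
      ⋂ n ∈ Icc a b, {y : X | (y : ℤ → Fin k) (c - n) = (y : ℤ → Fin k) n} := by
    ext y
    simp only [mem_ofPred_eq, mem_iInter, mem_Icc, and_imp]
  rw [h]
  refine (Set.finite_Icc a b).isOpen_biInter fun n _ => ?_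
  have hcont : Continuous fun y : X => ((y : ℤ → Fin k) (c - n), (y : ℤ → Fin k) n) :=
    ((continuous_apply (c - n)).comp continuous_subtype_val).prodMk
      ((continuous_apply n).comp continuous_subtype_val)
  exact (isOpen_discrete {p : Fin k × Fin k | p.1 = p.2}).preimage hcont

/-- Each word of `x` occurs to the left of the centre of a very long palindrome, at a distance which
is bounded independently of the length of the palindrome. Shifting `x`, one obtains sequences
close to a given one with palindromes as long as desired about a centre that is not too far. -/
theorem IsArnouxRauzy.exists_shift_palindrome (hk : 2 ≤ k) (hx : IsArnouxRauzy x) {g : ℕ → ℕ}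
    (hg : Monotone g) (M N : ℕ) {u : List (Fin k)} (hu : u ∈ factors x M) (a : ℤ) :
    ∃ m : ℤ, subword x (a + m) M = u ∧ ∃ c : ℕ, N ≤ c ∧
      ∀ n : ℤ, -(g c : ℤ) ≤ n → n ≤ c + g c → x (c - n + m) = x (n + m) := by
  obtain ⟨R, hR⟩ := hx.uniformlyRecurrent M u hu
  obtain ⟨i, L, hL, hpal⟩ := hx.exists_palindrome hk (1 + (N + 2 * R + 2) + 2 * g (N + 2 * R + 2))
  -- An occurrence `j` of `u` for which `c = 2 * i + L - 1 - 2 * (j - a)` lies between `N` and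
  -- `N + 2 * R + 2`, whatever `L` is.
  obtain ⟨j, hj, hj', hu'⟩ := hR ((2 * i + L - 1 - N) / 2 - R + a)
  obtain ⟨c, hc⟩ : ∃ c : ℕ, (c : ℤ) = 2 * i + L - 1 - 2 * (j - a) :=
    ⟨(2 * i + L - 1 - 2 * (j - a)).toNat, Int.toNat_of_nonneg (by omega)⟩
  have hc' : c ≤ N + 2 * R + 2 := by omega
  have hgc := hg hc'
  refine ⟨j - a, by simpa using hu', c, by omega, fun n hn hn' => ?_⟩
  rw [← hpal (n + (j - a)) (by omega) (by omega)]
  congr 1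
  omega

theorem dense_setOf_palindrome (hk : 2 ≤ k) {X : Set (ℤ → Fin k)} (hX : IsArnouxRauzySubshift X)
    {g : ℕ → ℕ} (hg : Monotone g) (N : ℕ) :
    Dense {y : X | ∃ c : ℕ, N ≤ c ∧ ∀ n : ℤ, -(g c : ℤ) ≤ n → n ≤ c + g c →
      (y : ℤ → Fin k) (c - n) = (y : ℤ → Fin k) n} := by
  obtain ⟨x, hx, rfl⟩ := hX
  intro y
  rw [mem_closure_iff_nhds]
  intro U hU
  rw [nhds_subtype, Filter.mem_comap] at hU
  obtain ⟨V, hV, hVU⟩ := hU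
  rw [nhds_pi, Filter.mem_pi] at hV
  obtain ⟨I, hI, t, ht, htV⟩ := hV
  obtain ⟨b, hb⟩ := hI.bddAbove
  obtain ⟨a, ha⟩ := hI.bddBelow
  obtain ⟨m, hm, c, hc, hpal⟩ := hx.exists_shift_palindrome hk hg (b + 1 - a).toNat N
    ((hx.uniformlyRecurrent.factors_eq_iff.1 y.2) _ a) a
  refine ⟨⟨fun i => x (i + m), fun n _ => factors_comp_add x m n⟩, hVU (htV fun i hi => ?_), c, hc,
    fun n hn hn' => hpal n hn hn'⟩
  have h1 := subword_eq_iff.1 hm (i - a) (by have := ha hi; omega)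
    (by have := hb hi; have := ha hi; omega)
  have h2 : x (i + m) = (y : ℤ → Fin k) i := by
    convert h1 using 2 <;> ring
  change x (i + m) ∈ t i
  rw [h2]
  exact mem_of_mem_nhds (ht i)

theorem isGδ_dense_stronglyPalindromic (hk : 2 ≤ k) {X : Set (ℤ → Fin k)}
    (hX : IsArnouxRauzySubshift X) :
    IsGδ {y : X | IsStronglyPalindromic (y : ℤ → Fin k)} ∧
      Dense {y : X | IsStronglyPalindromic (y : ℤ → Fin k)} := by
  have hmono : Monotone fun c : ℕ => (c + 1) ^ (2 * c + 4) := fun c d hcd =>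
    (Nat.pow_le_pow_left (by omega) _).trans (Nat.pow_le_pow_right (by omega) (by omega))
  have hopen : ∀ N : ℕ, IsOpen {y : X | ∃ c : ℕ, N ≤ c ∧
      ∀ n : ℤ, -((c + 1) ^ (2 * c + 4) : ℕ) ≤ n → n ≤ c + ((c + 1) ^ (2 * c + 4) : ℕ) →
        (y : ℤ → Fin k) (c - n) = (y : ℤ → Fin k) n} := by
    intro N
    simp only [ofPred_exists, ofPred_and]
    exact isOpen_iUnion fun c => isOpen_const.inter (isOpen_setOf_palindrome _ _ _)
  have : CompactSpace X := isCompact_iff_compactSpace.1 (isClosed_of_arnouxRauzy hX).isCompact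
  simp only [IsStronglyPalindromic, ofPred_forall]
  exact ⟨.iInter fun N => (hopen N).isGδ,
    dense_iInter_of_isOpen_nat hopen fun N => dense_setOf_palindrome hk hX hmono N⟩

end Generic

/-! ### Strongly palindromic potentials have no eigenvalues -/

section Palindromic

open Filter Topology

/-- The Wronskian of `φ` and of its reflection `n ↦ φ (c - n)` about `c / 2`. -/
def reflectedWronskian (φ : ℤ → ℂ) (c n : ℤ) : ℂ :=
  φ (n + 1) * φ (c - n) - φ n * φ (c - (n + 1))

variable {V : ℤ → ℝ} {E : ℂ} {φ : ℤ → ℂ}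

/-- Where the potential is symmetric about `c / 2`, the Wronskian is constant. -/
theorem reflectedWronskian_eq (hφ : ∀ n, φ (n + 1) + φ (n - 1) + V n * φ n = E * φ n) {c n : ℤ}
    (hV : V (c - n) = V n) : reflectedWronskian φ c n = reflectedWronskian φ c (n - 1) := by
  have h1 := hφ n
  have h2 := hφ (c - n)
  rw [hV] at h2
  simp only [reflectedWronskian, sub_add_cancel, ← sub_sub]
  have h3 : c - (n - 1) = c - n + 1 := by ring
  rw [h3]
  linear_combination φ (c - n) * h1 - φ n * h2

theorem reflectedWronskian_eq_zero (hφ : ∀ n, φ (n + 1) + φ (n - 1) + V n * φ n = E * φ n) {c : ℤ}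
    {R : ℕ} (hV : ∀ n : ℤ, 0 ≤ n → n ≤ R → V (c - n) = V n) (n : ℕ) (hn : n ≤ R) :
    reflectedWronskian φ c n = reflectedWronskian φ c 0 := by
  induction n with
  | zero => rfl
  | succ n ih =>
    rw [reflectedWronskian_eq hφ (hV _ (by omega) (by omega)), ← ih (by omega)]
    congr 1
    push_cast
    ring

/-- A Wronskian which is constant on `M` sites is of order `1 / M`, because it is summable. -/
theorem natCast_mul_norm_reflectedWronskian_le (hs : Summable fun n => ‖φ n‖ ^ 2) {c : ℤ} {M : ℕ}
    (h : ∀ n : ℕ, n < M → reflectedWronskian φ c n = reflectedWronskian φ c 0) :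
    M * ‖reflectedWronskian φ c 0‖ ≤ 2 * ∑' n, ‖φ n‖ ^ 2 := by
  have hsum : ∀ e : ℕ → ℤ, Function.Injective e →
      ∑ i ∈ Finset.range M, ‖φ (e i)‖ ^ 2 ≤ ∑' n, ‖φ n‖ ^ 2 := fun e he =>
    ((hs.comp_injective he).sum_le_tsum _ fun _ _ => sq_nonneg _).trans
      (tsum_comp_le_tsum_of_inj hs (fun _ => sq_nonneg _) he)
  have h1 := hsum (fun i => i + 1) fun i j hij => by simpa using hij
  have h2 := hsum (fun i => c - i) fun i j hij => by simpa using hij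
  have h3 := hsum (fun i => i) fun i j hij => by simpa using hij
  have h4 := hsum (fun i => c - (i + 1)) fun i j hij => by simpa using hij
  have h5 : ∀ i ∈ Finset.range M, ‖reflectedWronskian φ c 0‖ ≤ (‖φ (i + 1)‖ ^ 2 +
      ‖φ (c - i)‖ ^ 2 + ‖φ i‖ ^ 2 + ‖φ (c - (i + 1))‖ ^ 2) / 2 := by
    intro i hi
    rw [← h i (Finset.mem_range.1 hi), reflectedWronskian]
    refine (norm_sub_le _ _).trans ?_
    rw [norm_mul, norm_mul]
    nlinarith [sq_nonneg (‖φ (i + 1)‖ - ‖φ (c - i)‖), sq_nonneg (‖φ i‖ - ‖φ (c - (i + 1))‖)]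
  have h6 := Finset.sum_le_sum h5
  rw [Finset.sum_const, Finset.card_range, nsmul_eq_mul, ← Finset.sum_div, Finset.sum_add_distrib,
    Finset.sum_add_distrib, Finset.sum_add_distrib] at h6
  linarith

theorem norm_le_or_norm_le_of_norm_mul_le {a b : ℂ} {δ : ℝ} (hδ : 0 ≤ δ) (h : ‖a * b‖ ≤ δ ^ 2) :
    ‖a‖ ≤ δ ∨ ‖b‖ ≤ δ := by
  by_contra! hc
  rw [norm_mul] at h
  nlinarith [hc.1, hc.2]

/-- If the Wronskian is small at the centre, then `φ` is almost even or almost odd there. -/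
theorem exists_sign_norm_le (hφ : ∀ n, φ (n + 1) + φ (n - 1) + V n * φ n = E * φ n) {K : ℝ}
    (hK : 1 ≤ K) (hKV : ∀ n, ‖E - V n‖ ≤ K) {δ : ℝ} (hδ : 0 ≤ δ) {c m : ℤ}
    (hm : c = 2 * m ∨ c = 2 * m + 1) (hW : ‖reflectedWronskian φ c m‖ ≤ δ ^ 2) :
    ∃ σ : ℂ, ‖σ‖ = 1 ∧ ‖φ m + σ * φ (c - m)‖ ≤ 2 * K * δ ∧
      ‖φ (m + 1) + σ * φ (c - (m + 1))‖ ≤ 2 * K * δ := by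
  have hδK : δ ≤ K * δ := le_mul_of_one_le_left hδ hK
  rcases hm with rfl | rfl
  · have e1 : 2 * m - m = m := by ring
    have e2 : 2 * m - (m + 1) = m - 1 := by ring
    rw [e1, e2]
    rw [reflectedWronskian, e1, e2,
      show φ (m + 1) * φ m - φ m * φ (m - 1) = φ m * (φ (m + 1) - φ (m - 1)) by ring] at hW
    rcases norm_le_or_norm_le_of_norm_mul_le hδ hW with h | h
    · refine ⟨1, by simp, ?_, ?_⟩
      · rw [show φ m + 1 * φ m = 2 * φ m by ring, norm_mul, RCLike.norm_ofNat]
        linarith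
      · rw [show φ (m + 1) + 1 * φ (m - 1) = (E - V m) * φ m by linear_combination hφ m, norm_mul]
        have := mul_le_mul (hKV m) h (norm_nonneg _) (by linarith)
        linarith
    · refine ⟨-1, by simp, ?_, ?_⟩
      · rw [show φ m + -1 * φ m = 0 by ring, norm_zero]
        positivity
      · rw [show φ (m + 1) + -1 * φ (m - 1) = φ (m + 1) - φ (m - 1) by ring]
        linarith
  · have e1 : 2 * m + 1 - m = m + 1 := by ring
    have e2 : 2 * m + 1 - (m + 1) = m := by ring
    rw [e1, e2]
    rw [reflectedWronskian, e1, e2, show φ (m + 1) * φ (m + 1) - φ m * φ m =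
      (φ (m + 1) + φ m) * (φ (m + 1) - φ m) by ring] at hW
    rcases norm_le_or_norm_le_of_norm_mul_le hδ hW with h | h
    · refine ⟨1, by simp, ?_, ?_⟩
      · rw [one_mul, add_comm]
        linarith
      · rw [one_mul]
        linarith
    · refine ⟨-1, by simp, ?_, ?_⟩
      · rw [show φ m + -1 * φ (m + 1) = -(φ (m + 1) - φ m) by ring, norm_neg]
        linarith
      · rw [neg_one_mul, ← sub_eq_add_neg]
        linarith

/-- A solution grows at most by the factor `K + 1` from one site to the next. -/
theorem norm_le_pow_mul_of_solution {D : ℤ → ℂ} {K B : ℝ} (hK : 0 ≤ K) (hKV : ∀ n, ‖E - V n‖ ≤ K)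
    (m : ℕ) (hD : ∀ n : ℤ, 0 ≤ n → n ≤ m → D (n - 1) = (E - V n) * D n - D (n + 1))
    (h0 : ‖D m‖ ≤ B) (h1 : ‖D (m + 1)‖ ≤ B) :
    ‖D 0‖ ≤ (K + 1) ^ m * B ∧ ‖D 1‖ ≤ (K + 1) ^ m * B := by
  induction m generalizing B with
  | zero => simpa using And.intro h0 h1
  | succ m ih =>
    have hB : 0 ≤ B := (norm_nonneg _).trans h0
    push_cast at h0 h1
    have h2 := hD (m + 1) (by positivity) (by push_cast; rfl)
    have h3 := ih (B := (K + 1) * B) (fun n hn hn' => hD n hn (by push_cast; omega)) (by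
      rw [add_sub_cancel_right] at h2
      rw [h2]
      refine (norm_sub_le _ _).trans ?_
      rw [norm_mul]
      have := mul_le_mul (hKV (m + 1)) h0 (norm_nonneg _) hK
      linarith) (h0.trans (by nlinarith))
    rwa [pow_succ, mul_assoc]

/-- A solution which vanishes at two neighbouring sites vanishes everywhere. -/
theorem eq_zero_of_solution (hφ : ∀ n, φ (n + 1) + φ (n - 1) + V n * φ n = E * φ n)
    (h0 : φ 0 = 0) (h1 : φ 1 = 0) : φ = 0 := by
  have h : ∀ n : ℤ, φ n = 0 ∧ φ (n + 1) = 0 := by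
    intro n
    induction n using Int.induction_on with
    | zero => exact ⟨h0, by simpa using h1⟩
    | succ n ih =>
      have := hφ (n + 1)
      rw [add_sub_cancel_right, ih.1, ih.2] at this
      exact ⟨ih.2, by simpa using this⟩
    | pred n ih =>
      have := hφ (-n)
      rw [ih.1, ih.2] at this
      exact ⟨by simpa using this, by simpa using ih.1⟩
  exact funext fun n => (h n).1

/-- Absence of eigenfunctions. For a palindrome about `c / 2` the solution `φ` is almost even or
almost odd about `c / 2`, up to an error that is so small that it stays small when it is propagated to
the sites `0` and `1`. So `φ 0` and `φ 1` are almost as small as `φ c` and `φ (c - 1)`, which tend to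
zero as `c` tends to infinity. -/
theorem IsStronglyPalindromic.eq_zero_of_solution (hV : IsStronglyPalindromic V) {C : ℝ}
    (hC : ∀ n, |V n| ≤ C) (hφ : ∀ n, φ (n + 1) + φ (n - 1) + V n * φ n = E * φ n)
    (hs : Summable fun n => ‖φ n‖ ^ 2) : φ = 0 := by
  set S := ∑' n, ‖φ n‖ ^ 2 with hS
  have hS0 : 0 ≤ S := tsum_nonneg fun n => by positivity
  have hC0 : 0 ≤ C := (abs_nonneg _).trans (hC 0)
  obtain ⟨K, hK, hKV⟩ : ∃ K : ℝ, 1 ≤ K ∧ ∀ n, ‖E - V n‖ ≤ K := by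
    refine ⟨‖E‖ + C + 1, by linarith [norm_nonneg E], fun n => (norm_sub_le _ _).trans ?_⟩
    rw [Complex.norm_real, Real.norm_eq_abs]
    linarith [hC n]
  let F : ℕ → ℝ := fun c => ‖φ c‖ + ‖φ (c - 1)‖ + 2 * √(2 * S) * (1 / ((c : ℝ) + 1))
  have key : ∀ N : ℕ, ∃ c : ℕ, N ≤ c ∧ ‖φ 0‖ ≤ F c ∧ ‖φ 1‖ ≤ F c := by
    intro N
    obtain ⟨c, hc, hpal⟩ := hV (max N ⌈K⌉₊)
    have hcK : K ≤ c := (Nat.le_ceil K).trans (by exact_mod_cast (le_max_right _ _).trans hc)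
    refine ⟨c, (le_max_left _ _).trans hc, ?_⟩
    set M := (c + 1) ^ (2 * c + 4) with hM
    have hW := reflectedWronskian_eq_zero (c := c) (R := c + M) hφ fun n hn hn' =>
      hpal n (by omega) (by push_cast at hn' ⊢; omega)
    have hbound := natCast_mul_norm_reflectedWronskian_le (M := M) hs fun n hn => hW n (by omega)
    rw [← hS] at hbound
    -- `δ ^ 2 = 2 * S / M`
    set δ := √(2 * S) / ((c : ℝ) + 1) ^ (c + 2) with hδ
    have hδ0 : 0 ≤ δ := by positivity
    obtain ⟨m, hm⟩ : ∃ m : ℕ, (c : ℤ) = 2 * m ∨ (c : ℤ) = 2 * m + 1 := ⟨c / 2, by omega⟩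
    have hWm : ‖reflectedWronskian φ c m‖ ≤ δ ^ 2 := by
      rw [hW m (by omega), hδ, div_pow, Real.sq_sqrt (by positivity), ← pow_mul,
        le_div_iff₀ (by positivity), mul_comm]
      refine le_trans (le_of_eq ?_) hbound
      rw [hM]
      push_cast
      ring_nf
    obtain ⟨σ, hσ, h0, h1⟩ := exists_sign_norm_le hφ hK hKV hδ0 hm hWm
    have hD := norm_le_pow_mul_of_solution (D := fun n => φ n + σ * φ (c - n)) (by linarith) hKV m
      (fun n hn hn' => by
        have e1 := hφ n
        have e2 := hφ (c - n)
        rw [hpal n (by omega) (by omega)] at e2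
        have e3 : (c : ℤ) - (n - 1) = c - n + 1 := by ring
        have e4 : (c : ℤ) - (n + 1) = c - n - 1 := by ring
        simp only [e3, e4]
        linear_combination e1 + σ * e2) h0 h1
    have hsmall : (K + 1) ^ m * (2 * K * δ) ≤ 2 * √(2 * S) * (1 / ((c : ℝ) + 1)) := by
      have hc1 : (1 : ℝ) ≤ c + 1 := by linarith
      have h2 : (K + 1) ^ m ≤ ((c : ℝ) + 1) ^ c :=
        (pow_le_pow_left₀ (by linarith) (by linarith) m).trans
          (pow_le_pow_right₀ hc1 (by omega))
      have h3 : (K + 1) ^ m * K ≤ ((c : ℝ) + 1) ^ (c + 1) := by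
        rw [pow_succ]
        exact mul_le_mul h2 (by linarith) (by linarith) (by positivity)
      calc (K + 1) ^ m * (2 * K * δ) = (K + 1) ^ m * K * (2 * δ) := by ring
        _ ≤ ((c : ℝ) + 1) ^ (c + 1) * (2 * δ) := by gcongr
        _ = 2 * √(2 * S) * (1 / ((c : ℝ) + 1)) := by
          rw [hδ]
          field_simp
          ring
    have hfin : ∀ a b : ℂ, ‖a‖ ≤ ‖a + σ * b‖ + ‖b‖ := by
      intro a b
      calc ‖a‖ = ‖a + σ * b - σ * b‖ := by rw [add_sub_cancel_right]
        _ ≤ ‖a + σ * b‖ + ‖σ * b‖ := norm_sub_le _ _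
        _ = ‖a + σ * b‖ + ‖b‖ := by rw [norm_mul, hσ, one_mul]
    have h2 := hfin (φ 0) (φ c)
    have h3 := hfin (φ 1) (φ (c - 1))
    simp only [sub_zero] at hD
    constructor
    · simp only [F]
      linarith [norm_nonneg (φ (c - 1)), hD.1]
    · simp only [F]
      linarith [norm_nonneg (φ c), hD.2]
  have hlim : Tendsto F atTop (𝓝 0) := by
    have h1 : ∀ a : ℤ, Tendsto (fun c : ℕ => ‖φ (c - a)‖) atTop (𝓝 0) := by
      intro a
      have h2 : Summable fun c : ℕ => ‖φ (c - a)‖ ^ 2 :=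
        hs.comp_injective (i := fun c : ℕ => (c : ℤ) - a) fun i j hij => by simpa using hij
      have h3 := h2.tendsto_atTop_zero.sqrt
      simpa [Real.sqrt_sq] using h3
    have h2 := ((h1 0).add (h1 1)).add
      ((tendsto_one_div_add_atTop_nhds_zero_nat (𝕜 := ℝ)).const_mul (2 * √(2 * S)))
    simpa [F] using h2
  have hfreq : ∃ᶠ c in atTop, ‖φ 0‖ ≤ F c ∧ ‖φ 1‖ ≤ F c := by
    rw [frequently_atTop]
    exact fun N => (key N).imp fun c hc => hc
  have h0 := ge_of_tendsto_of_frequently hlim (hfreq.mono fun c hc => hc.1)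
  have h1 := ge_of_tendsto_of_frequently hlim (hfreq.mono fun c hc => hc.2)
  exact _root_.eq_zero_of_solution hφ (by simpa using h0) (by simpa using h1)

theorem IsStronglyPalindromic.comp {A B : Type*} {x : ℤ → A} (hx : IsStronglyPalindromic x)
    (f : A → B) : IsStronglyPalindromic fun n => f (x n) := fun N => by
  obtain ⟨c, hc, h⟩ := hx N
  exact ⟨c, hc, fun n hn hn' => congrArg f (h n hn hn')⟩

theorem IsStronglyPalindromic.not_hasEigenvalue {k : ℕ} {x : ℤ → Fin k}
    (hx : IsStronglyPalindromic x) (f : Fin k → ℝ) (E : ℂ) :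
    ¬ Module.End.HasEigenvalue (schrodingerOfSeq f x : EllTwo →ₗ[ℂ] EllTwo) E := by
  intro h
  obtain ⟨φ, hφ⟩ := h.exists_hasEigenvector
  refine hφ.2 ?_
  have heq := hφ.apply_eq_smul
  have hs : Summable fun n => ‖φ n‖ ^ 2 := by
    simpa using (memℓp_gen_iff (p := 2) (by norm_num)).1 φ.2
  have h0 : (φ : ℤ → ℂ) = 0 := by
    refine (hx.comp f).eq_zero_of_solution (C := ∑ a, |f a|) (E := E)
      (fun n => Finset.single_le_sum (f := fun a => |f a|) (fun a _ => abs_nonneg (f a))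
        (Finset.mem_univ (x n))) (fun n => ?_) hs
    exact congrArg (fun ψ : EllTwo => ψ n) heq
  ext n
  exact congrFun h0 n

end Palindromic

/-! ### Self-adjoint operators without eigenvalues have no pure point spectrum -/

section SpectralMeasure

open Filter Topology

theorem sub_algebraMap_apply {E : Type*} [NormedAddCommGroup E] [InnerProductSpace ℂ E]
    (T : E →L[ℂ] E) (z : ℂ) (ψ : E) : (T - algebraMap ℂ (E →L[ℂ] E) z) ψ = T ψ - z • ψ := by
  simp [Algebra.algebraMap_eq_smul_one]

variable {E : Type*} [NormedAddCommGroup E] [InnerProductSpace ℂ E] [CompleteSpace E]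
  {T : E →L[ℂ] E}

theorem IsSelfAdjoint.im_inner_sub_algebraMap (hT : IsSelfAdjoint T) (z : ℂ) (ψ : E) :
    (inner ℂ ψ ((T - algebraMap ℂ (E →L[ℂ] E) z) ψ) : ℂ).im = -z.im * ‖ψ‖ ^ 2 := by
  have h := (ContinuousLinearMap.isSelfAdjoint_iff_isSymmetric.1 hT).im_inner_self_apply ψ
  have h' : (inner ℂ ψ (T ψ) : ℂ).im = 0 := h
  rw [sub_algebraMap_apply, inner_sub_right, inner_smul_right, inner_self_eq_norm_sq_to_K,
    Complex.sub_im, h']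
  simp [← Complex.ofReal_pow]

theorem IsSelfAdjoint.isUnit_sub_algebraMap (hT : IsSelfAdjoint T) {z : ℂ} (hz : 0 < z.im) :
    IsUnit (T - algebraMap ℂ (E →L[ℂ] E) z) := by
  have h : z ∉ spectrum ℂ T := fun h => hz.ne' (hT.im_eq_zero_of_mem_spectrum h)
  rw [spectrum.notMem_iff, ← IsUnit.neg_iff, neg_sub] at h
  exact h

theorem IsSelfAdjoint.sub_algebraMap_inverse_apply (hT : IsSelfAdjoint T) {z : ℂ} (hz : 0 < z.im)
    (φ : E) : (T - algebraMap ℂ (E →L[ℂ] E) z)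
      (Ring.inverse (T - algebraMap ℂ (E →L[ℂ] E) z) φ) = φ := by
  have h := Ring.mul_inverse_cancel _ (hT.isUnit_sub_algebraMap hz)
  simpa using congrArg (fun A : E →L[ℂ] E => A φ) h

theorem IsSelfAdjoint.inverse_sub_algebraMap_apply (hT : IsSelfAdjoint T) {z : ℂ} (hz : 0 < z.im)
    (φ : E) : Ring.inverse (T - algebraMap ℂ (E →L[ℂ] E) z)
      ((T - algebraMap ℂ (E →L[ℂ] E) z) φ) = φ := by
  have h := Ring.inverse_mul_cancel _ (hT.isUnit_sub_algebraMap hz)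
  simpa using congrArg (fun A : E →L[ℂ] E => A φ) h

/-- The resolvent at `z` is bounded by `1 / Im z`. -/
theorem IsSelfAdjoint.im_mul_norm_resolvent_le (hT : IsSelfAdjoint T) {z : ℂ} (hz : 0 < z.im)
    (φ : E) : z.im * ‖Ring.inverse (T - algebraMap ℂ (E →L[ℂ] E) z) φ‖ ≤ ‖φ‖ := by
  have h1 := hT.sub_algebraMap_inverse_apply hz φ
  set ψ := Ring.inverse (T - algebraMap ℂ (E →L[ℂ] E) z) φ
  have h2 := hT.im_inner_sub_algebraMap z ψ
  rw [h1] at h2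
  have h3 : z.im * ‖ψ‖ ^ 2 ≤ ‖ψ‖ * ‖φ‖ := by
    have := (Complex.abs_im_le_norm _).trans (norm_inner_le_norm (𝕜 := ℂ) ψ φ)
    rw [h2, neg_mul, abs_neg] at this
    exact (le_abs_self _).trans this
  rcases (norm_nonneg ψ).eq_or_lt with h4 | h4
  · rw [← h4, mul_zero]
    exact norm_nonneg φ
  · exact le_of_mul_le_mul_left (by linarith) h4

theorem IsSelfAdjoint.dense_range_sub (hT : IsSelfAdjoint T) {a : ℝ}
    (ha : ∀ ψ : E, T ψ = (a : ℂ) • ψ → ψ = 0) (φ : E) {η : ℝ} (hη : 0 < η) :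
    ∃ ψ : E, ‖φ - (T ψ - (a : ℂ) • ψ)‖ < η := by
  set A := T - algebraMap ℂ (E →L[ℂ] E) (a : ℂ)
  have hA : IsSelfAdjoint A := by
    refine hT.sub ?_
    rw [IsSelfAdjoint, ← algebraMap_star_comm]
    simp
  have hker : (A : E →ₗ[ℂ] E).ker = ⊥ := by
    rw [LinearMap.ker_eq_bot']
    intro ψ hψ
    have h : A ψ = 0 := hψ
    rw [sub_algebraMap_apply, sub_eq_zero] at h
    exact ha ψ h
  have h1 : (A : E →ₗ[ℂ] E).range.topologicalClosure = ⊤ := by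
    rw [Submodule.topologicalClosure_eq_top_iff, A.orthogonal_range, hA.adjoint_eq, hker]
  have h2 : φ ∈ closure ((A : E →ₗ[ℂ] E).range : Set E) := by
    rw [← Submodule.topologicalClosure_coe, h1]
    trivial
  obtain ⟨_, ⟨ψ, rfl⟩, h⟩ := Metric.mem_closure_iff.1 h2 η hη
  refine ⟨ψ, ?_⟩
  rw [← sub_algebraMap_apply, ← dist_eq_norm]
  exact h

/-- The weight of the resolvent at a real point which is not an eigenvalue tends to zero: this is
clear on the range of `T - a`, which is dense, and the operators in question are contractions. -/
theorem IsSelfAdjoint.tendsto_smul_resolvent (hT : IsSelfAdjoint T) {a : ℝ}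
    (ha : ∀ ψ : E, T ψ = (a : ℂ) • ψ → ψ = 0) (φ : E) :
    Tendsto (fun ε : ℝ => (ε : ℂ) •
      Ring.inverse (T - algebraMap ℂ (E →L[ℂ] E) (a + ε * Complex.I)) φ) (𝓝[>] 0) (𝓝 0) := by
  rw [Metric.tendsto_nhds]
  intro η hη
  obtain ⟨ψ, hψ⟩ := hT.dense_range_sub ha φ (half_pos hη)
  have hsmall : ∀ᶠ ε : ℝ in 𝓝[>] 0, 2 * ε * ‖ψ‖ < η / 2 := by
    refine nhdsWithin_le_nhds ?_
    have : Tendsto (fun ε : ℝ => 2 * ε * ‖ψ‖) (𝓝 0) (𝓝 (2 * 0 * ‖ψ‖)) := by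
      exact Continuous.tendsto (by fun_prop) 0
    rw [mul_zero, zero_mul] at this
    exact this.eventually_lt_const (half_pos hη)
  filter_upwards [hsmall, self_mem_nhdsWithin] with ε hε hε0
  have hε0 : 0 < ε := hε0
  rw [dist_zero_right, norm_smul, Complex.norm_real, Real.norm_eq_abs, abs_of_pos hε0]
  set z : ℂ := a + ε * Complex.I with hz
  have hzim : z.im = ε := by simp [hz]
  have hzpos : 0 < z.im := hzim ▸ hε0
  set R := Ring.inverse (T - algebraMap ℂ (E →L[ℂ] E) z)
  have h1 : R (T ψ - (a : ℂ) • ψ) = ψ + (ε * Complex.I) • R ψ := by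
    have h2 : T ψ - (a : ℂ) • ψ = (T - algebraMap ℂ (E →L[ℂ] E) z) ψ + (ε * Complex.I) • ψ := by
      rw [sub_algebraMap_apply, hz, add_smul]
      abel
    rw [h2, map_add, map_smul, hT.inverse_sub_algebraMap_apply hzpos]
  have h2 := hT.im_mul_norm_resolvent_le hzpos ψ
  have h3 := hT.im_mul_norm_resolvent_le hzpos (φ - (T ψ - (a : ℂ) • ψ))
  rw [hzim] at h2 h3
  have h4 : ‖R φ‖ ≤ ‖R (φ - (T ψ - (a : ℂ) • ψ))‖ + (‖ψ‖ + ε * ‖R ψ‖) := by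
    have h5 : R φ = R (φ - (T ψ - (a : ℂ) • ψ)) + (ψ + (ε * Complex.I) • R ψ) := by
      rw [← h1, ← map_add, sub_add_cancel]
    have h6 : ‖(ε * Complex.I : ℂ) • R ψ‖ = ε * ‖R ψ‖ := by
      rw [norm_smul, norm_mul, Complex.norm_I, mul_one, Complex.norm_real, Real.norm_eq_abs,
        abs_of_pos hε0]
    rw [h5, ← h6]
    exact (norm_add_le _ _).trans (by gcongr; exact norm_add_le _ _)
  calc ε * ‖R φ‖ ≤ ε * (‖R (φ - (T ψ - (a : ℂ) • ψ))‖ + (‖ψ‖ + ε * ‖R ψ‖)) := by gcongr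
    _ = ε * ‖R (φ - (T ψ - (a : ℂ) • ψ))‖ + ε * ‖ψ‖ + ε * (ε * ‖R ψ‖) := by ring
    _ ≤ ‖φ - (T ψ - (a : ℂ) • ψ)‖ + ε * ‖ψ‖ + ε * ‖ψ‖ := by gcongr
    _ < η := by linarith

/-- The weight of a point is recovered from the Borel transform of a measure. -/
theorem tendsto_mul_borelTransform (μ : Measure ℝ) [IsFiniteMeasure μ] (a : ℝ) :
    Tendsto (fun ε : ℝ => -(ε * Complex.I) * ∫ t : ℝ, 1 / ((t : ℂ) - (a + ε * Complex.I)) ∂μ)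
      (𝓝[>] 0) (𝓝 (μ.real {a} : ℂ)) := by
  have hint : (μ.real {a} : ℂ) = ∫ t : ℝ, ({a} : Set ℝ).indicator (fun _ => (1 : ℂ)) t ∂μ := by
    rw [integral_indicator_const _ (measurableSet_singleton a)]
    simp
  simp_rw [hint, ← integral_const_mul]
  refine tendsto_integral_filter_of_dominated_convergence (fun _ => 1) ?_ ?_
    (integrable_const _) ?_
  · refine Eventually.of_forall fun ε => Measurable.aestronglyMeasurable ?_
    fun_prop
  · filter_upwards [self_mem_nhdsWithin] with ε hε0
    have hε0 : 0 < ε := hε0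
    refine ae_of_all _ fun t => ?_
    have h1 : ε ≤ ‖(t : ℂ) - (a + ε * Complex.I)‖ := by
      have := Complex.abs_im_le_norm ((t : ℂ) - (a + ε * Complex.I))
      simp only [Complex.sub_im, Complex.ofReal_im, Complex.add_im, Complex.mul_im,
        Complex.ofReal_re, Complex.I_im, Complex.I_re, mul_one, mul_zero, add_zero, zero_add,
        zero_sub, abs_neg] at this
      exact (le_abs_self ε).trans this
    rw [norm_mul, norm_neg, norm_mul, Complex.norm_I, mul_one, Complex.norm_real, Real.norm_eq_abs,
      abs_of_pos hε0, norm_div, norm_one, mul_one_div]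
    exact (div_le_one (hε0.trans_le h1)).2 h1
  · refine ae_of_all _ fun t => ?_
    by_cases hta : t = a
    · subst hta
      rw [indicator_of_mem (mem_singleton t)]
      refine tendsto_const_nhds.congr' ?_
      filter_upwards [self_mem_nhdsWithin] with ε hε0
      have hε0 : (ε : ℂ) ≠ 0 := Complex.ofReal_ne_zero.2 (ne_of_gt hε0)
      have h1 := Complex.I_ne_zero
      rw [sub_add_cancel_left, mul_one_div, div_self (neg_ne_zero.2 (mul_ne_zero hε0 h1))]
    · rw [indicator_of_notMem (by simpa using hta)]
      refine tendsto_nhdsWithin_of_tendsto_nhds ?_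
      have h1 : ContinuousAt (fun ε : ℝ =>
          -(ε * Complex.I) * (1 / ((t : ℂ) - (a + ε * Complex.I)))) 0 := by
        have h2 : (t : ℂ) - (a + (0 : ℝ) * Complex.I) ≠ 0 := by
          simpa [sub_eq_zero] using hta
        refine ContinuousAt.mul (by fun_prop) (ContinuousAt.div (by fun_prop) (by fun_prop) h2)
      simpa [ContinuousAt] using h1

/-- The spectral measures of a self-adjoint operator give no weight to a real number which is not an
eigenvalue. -/
theorem IsSpectralMeasure.measure_singleton_eq_zero (hT : IsSelfAdjoint T) {φ : E} {μ : Measure ℝ}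
    (hμ : IsSpectralMeasure T φ μ) {a : ℝ} (ha : ∀ ψ : E, T ψ = (a : ℂ) • ψ → ψ = 0) :
    μ {a} = 0 := by
  have := hμ.1
  have h1 := tendsto_mul_borelTransform μ a
  have h2 : Tendsto (fun ε : ℝ => -Complex.I * inner ℂ φ ((ε : ℂ) •
      Ring.inverse (T - algebraMap ℂ (E →L[ℂ] E) (a + ε * Complex.I)) φ)) (𝓝[>] 0) (𝓝 0) := by
    have h3 := ((tendsto_const_nhds (x := φ)).inner (𝕜 := ℂ)
      (hT.tendsto_smul_resolvent ha φ)).const_mul (-Complex.I)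
    simpa only [inner_zero_right, mul_zero] using h3
  have h3 := tendsto_nhds_unique (h1.congr' ?_) h2
  · exact (measureReal_eq_zero_iff).1 (by exact_mod_cast h3)
  · filter_upwards [self_mem_nhdsWithin] with ε hε0
    have hε0 : 0 < ε := hε0
    rw [← hμ.2 _ (by simpa using hε0), inner_smul_right]
    ring

/-- Without eigenvalues, a spectral measure carried by a countable set is zero, and only the zero
vector has spectral measure zero. -/
theorem IsSelfAdjoint.purePointVectors_subset (hT : IsSelfAdjoint T)
    (h : ∀ z : ℂ, ¬ Module.End.HasEigenvalue (T : E →ₗ[ℂ] E) z) : purePointVectors T ⊆ {0} := by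
  rintro φ ⟨μ, hμ, S, hS, hSc⟩
  have ha : ∀ (a : ℝ) (ψ : E), T ψ = (a : ℂ) • ψ → ψ = 0 := by
    intro a ψ hψ
    by_contra hne
    exact h a (Module.End.hasEigenvalue_of_hasEigenvector
      ⟨Module.End.mem_eigenspace_iff.2 hψ, hne⟩)
  have hS0 : μ S = 0 := (measure_null_iff_singleton hS).2 fun a _ =>
    hμ.measure_singleton_eq_zero hT (ha a)
  have hμ0 : μ = 0 := by
    rw [← Measure.measure_univ_eq_zero, ← union_compl_self S]
    exact measure_union_null hS0 hSc
  have hI : 0 < Complex.I.im := by simp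
  -- With `ψ = (T - i)⁻¹ φ`, the imaginary part of `⟪ψ, (T - i) ψ⟫ = 0` is `-‖ψ‖ ^ 2`.
  have h1 := hμ.2 _ hI
  rw [hμ0, integral_zero_measure] at h1
  have h2 := hT.sub_algebraMap_inverse_apply hI φ
  set ψ := Ring.inverse (T - algebraMap ℂ (E →L[ℂ] E) Complex.I) φ
  have h3 := hT.im_inner_sub_algebraMap Complex.I ψ
  rw [h2, inner_eq_zero_symm.1 h1] at h3
  have h4 : ψ = 0 := by simpa using h3
  rw [mem_singleton_iff, ← h2, h4, map_zero]

theorem IsSelfAdjoint.ppSpectrum_eq_empty (hT : IsSelfAdjoint T)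
    (h : ∀ z : ℂ, ¬ Module.End.HasEigenvalue (T : E →ₗ[ℂ] E) z) : ppSpectrum T = ∅ := by
  have h1 : purePointSpace T = ⊥ := by
    rw [purePointSpace, Submodule.span_eq_bot.2 (hT.purePointVectors_subset h)]
    exact IsClosed.submodule_topologicalClosure_eq
      (Submodule.closed_of_finiteDimensional (⊥ : Submodule ℂ E))
  have : Subsingleton (purePointSpace T) := by
    rw [h1]
    infer_instance
  have : Subsingleton (purePointSpace T →L[ℂ] purePointSpace T) :=
    ⟨fun A B => ContinuousLinearMap.ext fun v => Subsingleton.elim _ _⟩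
  exact spectrum.of_subsingleton _

theorem inner_shiftOp_left (m : ℤ) (φ ψ : EllTwo) :
    inner ℂ (shiftOp m φ) ψ = inner ℂ φ (shiftOp (-m) ψ) := by
  rw [lp.inner_eq_tsum, lp.inner_eq_tsum,
    ← (Equiv.addRight m).tsum_eq fun n => inner ℂ (φ n) (shiftOp (-m) ψ n)]
  refine tsum_congr fun n => ?_
  change inner ℂ (φ (n + m)) (ψ n) = inner ℂ (φ (n + m)) (ψ (n + m + -m))
  rw [add_neg_cancel_right]

theorem inner_mulOp_left (V : ℤ → ℝ) (C : ℝ) (hC : ∀ n, |V n| ≤ C) (φ ψ : EllTwo) :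
    inner ℂ (mulOp V C hC φ) ψ = inner ℂ φ (mulOp V C hC ψ) := by
  rw [lp.inner_eq_tsum, lp.inner_eq_tsum]
  refine tsum_congr fun n => ?_
  change inner ℂ ((V n : ℂ) * φ n) (ψ n) = inner ℂ (φ n) ((V n : ℂ) * ψ n)
  rw [← smul_eq_mul, ← smul_eq_mul, inner_smul_left, inner_smul_right, Complex.conj_ofReal]

theorem isSelfAdjoint_schrodingerOp (V : ℤ → ℝ) (C : ℝ) (hC : ∀ n, |V n| ≤ C) :
    IsSelfAdjoint (schrodingerOp V C hC) := by
  rw [ContinuousLinearMap.isSelfAdjoint_iff_isSymmetric]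
  intro φ ψ
  change inner ℂ (shiftOp 1 φ + shiftOp (-1) φ + mulOp V C hC φ) ψ =
    inner ℂ φ (shiftOp 1 ψ + shiftOp (-1) ψ + mulOp V C hC ψ)
  simp only [inner_add_left, inner_add_right, inner_shiftOp_left, inner_mulOp_left, neg_neg]
  ring

end SpectralMeasure

theorem mainTheorem9 (k : ℕ) (hk : 2 ≤ k) (X : Set (ℤ → Fin k)) (hX : IsArnouxRauzySubshift X)
    (f : Fin k → ℝ) (hf : ∃ a b : Fin k, f a ≠ f b) :
    ∃ G : Set X, IsGδ G ∧ Dense G ∧ ∀ x ∈ G,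
      ppSpectrum (schrodingerOfSeq f (x : ℤ → Fin k)) = ∅ ∧
      ∀ E : ℂ, ¬ Module.End.HasEigenvalue
        (schrodingerOfSeq f (x : ℤ → Fin k) : EllTwo →ₗ[ℂ] EllTwo) E := by
  obtain ⟨hG, hdense⟩ := isGδ_dense_stronglyPalindromic hk hX
  refine ⟨_, hG, hdense, fun x hx => ?_⟩
  have hev := IsStronglyPalindromic.not_hasEigenvalue hx f
  exact ⟨(isSelfAdjoint_schrodingerOp _ _ _).ppSpectrum_eq_empty hev, hev⟩
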